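/- Let $N>3$ be prime. For a formal power series $x$ without constant term put $(x)_\infty=\prod_{k\ge 1}(1-x^k)$, and let $f(a,b)=\sum_{n=-\infty}^{\infty}a^{n(n+1)/2}b^{n(n-1)/2}$ be Ramanujan's theta function. There are unique formal power series $J_0,\dots,J_{N-1}\in\mathbb{Z}[[q]]$ with $$\frac{(q^{1/N})_\infty}{(q^N)_\infty}=\sum_{p=0}^{N-1}q^{p/N}J_p(q)$$ (as an identity of formal power series in $q^{1/N}$), and they satisfy the following. (I) Exactly $(N+1)/2$ of the series $J_0,\dots,J_{N-1}$ are non-zero; moreover, for $0\le p\le N-1$, $J_p\neq 0$ if and only if $p\equiv\frac{(N-6A)^2-1}{24}\pmod N$ for some integer $A\in[0,(N-1)/2]$. (II) If $0\le p\le N-1$ and $p\equiv\frac{N^2-1}{24}\pmod N$ (the case $A=0$), then $$J_p(q)=(-1)^{\lfloor (N+1)/6\rfloor}\,q^{\lfloor (N^2-1)/(24N)\rfloor}.$$ (III) If $A$ is an integer with $0<A\le (N-1)/2$, $0\le p\le N-1$ and $p\equiv\frac{(N-6A)^2-1}{24}\pmod N$, then $$J_p(q)=(-1)^{A+\lfloor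 (N+1)/6\rfloor}\,q^{\lfloor ((N-6A)^2-1)/(24N)\rfloor}\,\frac{f(-q^{2A},-q^{N-2A})}{f(-q^{A},-q^{N-A})}.$$ -/

import Mathlib

namespace RamanujanJ

open PowerSeries
open scoped PowerSeries.WithPiTopology

/-- The Euler function `(x)_∞ = ∏_{k ≥ 1} (1 - x ^ k)` at a formal power series `x` with integer
coefficients. The infinite product is taken coefficientwise (`ℤ` is discrete); it converges whenever
`x` has no constant term, in particular at `x = X ^ m` with `m ≥ 1` (`multipliable_euler`). -/
noncomputable def euler (x : ℤ⟦X⟧) : ℤ⟦X⟧ :=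
  ∏' k : ℕ, (1 - x ^ (k + 1))

/-- Ramanujan's theta function `f(a, b) = ∑_{n ∈ ℤ} a ^ (n (n + 1) / 2) * b ^ (n (n - 1) / 2)` at
formal power series `a, b` with integer coefficients. Both exponents are non-negative integers. The
sum is taken coefficientwise; it converges at `a = -X ^ i`, `b = -X ^ j` with `i, j ≥ 1`
(`summable_theta`). -/
noncomputable def theta (a b : ℤ⟦X⟧) : ℤ⟦X⟧ :=
  ∑' n : ℤ, a ^ (n * (n + 1) / 2).toNat * b ^ (n * (n - 1) / 2).toNat

/-- The quotient `f / g` of formal power series with integer coefficients, for `g` invertible. -/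
noncomputable def quot (f g : ℤ⟦X⟧) : ℤ⟦X⟧ :=
  f * Ring.inverse g

/-- The family `J_0, …, J_{N-1}` of power series in `q` with integer coefficients satisfies
`(q^{1/N})_∞ / (q^N)_∞ = ∑_{p=0}^{N-1} q^{p/N} J_p(q)`.
This is an identity in the ring of formal power series in `t = q^{1/N}`, which contains the power
series in `q` through `q = t ^ N`. -/
def IsExpansion (N : ℕ) (J : Fin N → ℤ⟦X⟧) : Prop :=
  let t : ℤ⟦X⟧ := X
  let q : ℤ⟦X⟧ := t ^ N
  quot (euler t) (euler (q ^ N)) = ∑ p : Fin N, t ^ (p : ℕ) * (J p).subst q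

theorem multipliable_euler {m : ℕ} (hm : 0 < m) :
    Multipliable fun k : ℕ ↦ (1 - ((X : ℤ⟦X⟧) ^ m) ^ (k + 1)) := by
  have h : Filter.Tendsto (fun k : ℕ ↦ (-((X : ℤ⟦X⟧) ^ m) ^ (k + 1)).order) Filter.atTop
      (nhds ⊤) := by
    simp_rw [order_neg, ← pow_mul, order_X_pow]
    refine ENat.tendsto_nhds_top_iff_natCast_lt.mpr fun n ↦
      Filter.eventually_atTop.mpr ⟨n, fun k hk ↦ ?_⟩
    norm_cast
    nlinarith
  simpa [sub_eq_add_neg] using WithPiTopology.multipliable_one_add_of_tendsto_order_atTop_nhds_top ℤ h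

theorem isUnit_euler {m : ℕ} (hm : 0 < m) : IsUnit (euler ((X : ℤ⟦X⟧) ^ m)) := by
  rw [isUnit_iff_constantCoeff, euler, (multipliable_euler hm).map_tprod _
    (WithPiTopology.continuous_constantCoeff ℤ)]
  simp [hm.ne']

theorem X_pow_dvd_theta_term {i j : ℕ} (hi : 0 < i) (hj : 0 < j) (n : ℤ) :
    (X : ℤ⟦X⟧) ^ n.natAbs ∣
      (-X ^ i) ^ (n * (n + 1) / 2).toNat * (-X ^ j) ^ (n * (n - 1) / 2).toNat := by
  have h1 : 0 ≤ n * (n + 1) / 2 := Int.ediv_nonneg (by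
    rcases le_or_gt 0 n with h | h <;> nlinarith) (by norm_num)
  have h2 : 0 ≤ n * (n - 1) / 2 := Int.ediv_nonneg (by
    rcases le_or_gt n 0 with h | h <;> nlinarith) (by norm_num)
  have h3 : n * (n + 1) / 2 * 2 = n * (n + 1) := Int.ediv_mul_cancel (Int.even_mul_succ_self n).two_dvd
  have h4 : n * (n - 1) / 2 * 2 = n * (n - 1) := Int.ediv_mul_cancel (Int.even_mul_pred_self n).two_dvd
  have h5 : n.natAbs ≤ (n * (n + 1) / 2).toNat + (n * (n - 1) / 2).toNat := by
    zify
    rw [Int.toNat_of_nonneg h1, Int.toNat_of_nonneg h2]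
    rcases le_or_gt 0 n with h | h
    · rw [abs_of_nonneg h]
      nlinarith
    · rw [abs_of_neg h]
      nlinarith
  refine (pow_dvd_pow X h5).trans ?_
  rw [pow_add]
  exact mul_dvd_mul (pow_dvd_pow_of_dvd ((dvd_pow_self X hi.ne').neg_right) _)
    (pow_dvd_pow_of_dvd ((dvd_pow_self X hj.ne').neg_right) _)

theorem summable_theta {i j : ℕ} (hi : 0 < i) (hj : 0 < j) :
    Summable fun n : ℤ ↦ (-(X : ℤ⟦X⟧) ^ i) ^ (n * (n + 1) / 2).toNat *
      (-(X : ℤ⟦X⟧) ^ j) ^ (n * (n - 1) / 2).toNat := by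
  rw [WithPiTopology.summable_iff_summable_coeff]
  intro d
  refine summable_of_hasFiniteSupport ((Set.finite_Icc (-(d : ℤ)) d).subset fun n hn ↦ ?_)
  by_contra h
  refine hn (X_pow_dvd_iff.mp (X_pow_dvd_theta_term hi hj n) d ?_)
  simp only [Set.mem_Icc] at h
  omega

theorem isUnit_theta {i j : ℕ} (hi : 0 < i) (hj : 0 < j) :
    IsUnit (theta (-X ^ i) (-X ^ j)) := by
  rw [isUnit_iff_constantCoeff, theta, (summable_theta hi hj).map_tsum _
    (WithPiTopology.continuous_constantCoeff ℤ), tsum_eq_single 0]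
  · simp
  · intro n hn
    rw [← coeff_zero_eq_constantCoeff_apply]
    exact X_pow_dvd_iff.mp (X_pow_dvd_theta_term hi hj n) 0 (by omega)

end RamanujanJ

namespace RamanujanJ

open PowerSeries
open scoped PowerSeries.WithPiTopology

/-! Euler's pentagonal number theorem gives (t)_∞ = ∑ (-1)^k t^(k(3k-1)/2). Since (q^N)_∞ is a
series in q = t^N, each J_p is forced: collect the terms with exponent ≡ p mod N and divide by
(q^N)_∞ (`isExpansion_iff`).

Write N = 6j + s with s = ±1. Completing the square, k(3k-1)/2 ≡ ((N-6A)²-1)/24 mod N exactly when k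
≡ ±A - sj, so the residues that occur are indexed by 0 ≤ A ≤ (N-1)/2. For A = 0 there is one
progression of k, and its terms reassemble into a signed monomial times (q^N)_∞
(`dissection_euler_zero`). For A > 0 there are two, giving a signed monomial times `quintuple N A`
(`dissection_euler_pos`); the quintuple product identity `theta_mul_euler` then turns the quotient
by (q^N)_∞ into a quotient of theta functions. These are units, so the corresponding J_p do not
vanish. -/

/-! ### Signed monomials and their double sums. -/

/-- The monomial `(-1) ^ k * X ^ e`, for integers `k` and `e` with `0 ≤ e`. -/
noncomputable def signedMonomial (k e : ℤ) : ℤ⟦X⟧ :=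
  ((Int.negOnePow k : ℤ) : ℤ⟦X⟧) * X ^ e.toNat

theorem signedMonomial_mul {k l e f : ℤ} (he : 0 ≤ e) (hf : 0 ≤ f) :
    signedMonomial k e * signedMonomial l f = signedMonomial (k + l) (e + f) := by
  simp only [signedMonomial, Int.negOnePow_add, Int.toNat_add he hf, pow_add, Units.val_mul,
    Int.cast_mul]
  ring

theorem signedMonomial_congr {k l e f : ℤ} (hkl : Even (k - l)) (hef : e = f) :
    signedMonomial k e = signedMonomial l f := by
  rw [signedMonomial, signedMonomial, hef, (Int.negOnePow_eq_iff k l).mpr hkl]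

theorem signedMonomial_eq_neg {k l e f : ℤ} (hkl : Odd (k - l)) (hef : e = f) :
    signedMonomial k e = -signedMonomial l f := by
  have h : k = (k - l) + l := by ring
  rw [signedMonomial, signedMonomial, hef, h, Int.negOnePow_add, Int.negOnePow_odd _ hkl]
  simp

theorem coeff_signedMonomial (k e : ℤ) (d : ℕ) :
    coeff d (signedMonomial k e) = if d = e.toNat then (Int.negOnePow k : ℤ) else 0 := by
  rw [signedMonomial, ← map_intCast (C (R := ℤ)), coeff_C_mul, coeff_X_pow, mul_ite, mul_one,
    mul_zero, Int.cast_id]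

theorem summable_signedMonomial {ι : Type*} (k e : ι → ℤ) (he : ∀ d : ℕ, {i | e i ≤ d}.Finite) :
    Summable fun i ↦ signedMonomial (k i) (e i) := by
  rw [WithPiTopology.summable_iff_summable_coeff]
  intro d
  refine summable_of_hasFiniteSupport ((he d).subset fun i hi ↦ ?_)
  rw [Function.mem_support, coeff_signedMonomial] at hi
  have h : d = (e i).toNat := by
    by_contra h
    exact hi (if_neg h)
  simp only [Set.mem_ofPred_eq]
  omega

-- Regularity is what lets `HasSum.mul` multiply two series into a double series.
instance : T3Space ℤ⟦X⟧ :=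
  inferInstanceAs (T3Space ((Unit →₀ ℕ) → ℤ))

theorem finite_setOf_le_of_abs_le {e : ℤ → ℤ} (he : ∀ n, |n| ≤ e n) (d : ℕ) :
    {n | e n ≤ d}.Finite :=
  (Set.finite_Icc (-(d : ℤ)) d).subset fun n hn ↦ abs_le.mp ((he n).trans hn)

theorem finite_setOf_add_le {ι κ : Type*} {e : ι → ℤ} {f : κ → ℤ}
    (he : ∀ d : ℕ, {i | e i ≤ d}.Finite) (hf : ∀ d : ℕ, {i | f i ≤ d}.Finite)
    (he0 : ∀ i, 0 ≤ e i) (hf0 : ∀ i, 0 ≤ f i) (d : ℕ) :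
    {i : ι × κ | e i.1 + f i.2 ≤ d}.Finite :=
  ((he d).prod (hf d)).subset fun i hi ↦ by
    have h1 := hf0 i.2
    have h2 := he0 i.1
    simp only [Set.mem_ofPred_eq, Set.mem_prod] at hi ⊢
    omega

theorem hasSum_signedMonomial_mul {k l e f : ℤ → ℤ} {x y : ℤ⟦X⟧}
    (he : ∀ n, |n| ≤ e n) (hf : ∀ n, |n| ≤ f n)
    (hx : HasSum (fun i ↦ signedMonomial (k i) (e i)) x)
    (hy : HasSum (fun i ↦ signedMonomial (l i) (f i)) y) :
    HasSum (fun i : ℤ × ℤ ↦ signedMonomial (k i.1 + l i.2) (e i.1 + f i.2)) (x * y) := by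
  have he0 n : 0 ≤ e n := (abs_nonneg n).trans (he n)
  have hf0 n : 0 ≤ f n := (abs_nonneg n).trans (hf n)
  have h := summable_signedMonomial (fun i : ℤ × ℤ ↦ k i.1 + l i.2) (fun i ↦ e i.1 + f i.2)
    (finite_setOf_add_le (finite_setOf_le_of_abs_le he) (finite_setOf_le_of_abs_le hf)
      he0 hf0)
  simp only [← signedMonomial_mul (he0 _) (hf0 _)] at h ⊢
  exact HasSum.mul (f := fun i ↦ signedMonomial (k i) (e i))
    (g := fun i ↦ signedMonomial (l i) (f i)) hx hy h

theorem hasSum_of_disjoint_ranges {ι κ M : Type*} [AddCommMonoid M] [TopologicalSpace M]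
    [ContinuousAdd M] {f : κ → M} {i j : ι → κ} {a b : M} (hi : i.Injective) (hj : j.Injective)
    (hij : ∀ x y, i x ≠ j y) (hf : ∀ k, f k ≠ 0 → (∃ x, i x = k) ∨ ∃ x, j x = k)
    (ha : HasSum (f ∘ i) a) (hb : HasSum (f ∘ j) b) : HasSum f (a + b) := by
  have hd : Disjoint (Set.range i) (Set.range j) := by
    rw [Set.disjoint_left]
    rintro _ ⟨x, rfl⟩ ⟨y, hy⟩
    exact hij x y hy.symm
  refine (hasSum_subtype_iff_of_support_subset (s := Set.range i ∪ Set.range j) ?_).mp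
    (HasSum.add_disjoint hd (hi.hasSum_range_iff.mpr ha) (hj.hasSum_range_iff.mpr hb))
  exact fun k hk ↦ hf k hk

theorem hasSum_of_parity {M : Type*} [AddCommMonoid M] [TopologicalSpace M]
    [ContinuousAdd M] {f : ℤ × ℤ → M} {a b : M}
    (ha : HasSum (fun u : ℤ × ℤ ↦ f (u.1 + u.2, u.1 - u.2)) a)
    (hb : HasSum (fun u : ℤ × ℤ ↦ f (u.1 + u.2 + 1, u.1 - u.2)) b) : HasSum f (a + b) := by
  refine hasSum_of_disjoint_ranges (i := fun u : ℤ × ℤ ↦ (u.1 + u.2, u.1 - u.2))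
    (j := fun u : ℤ × ℤ ↦ (u.1 + u.2 + 1, u.1 - u.2)) ?_ ?_ ?_ ?_ ha hb
  · rintro ⟨u, v⟩ ⟨u', v'⟩ h
    simp only [Prod.mk.injEq] at h ⊢
    omega
  · rintro ⟨u, v⟩ ⟨u', v'⟩ h
    simp only [Prod.mk.injEq] at h ⊢
    omega
  · rintro ⟨u, v⟩ ⟨u', v'⟩ h
    simp only [Prod.mk.injEq] at h
    omega
  · rintro ⟨m, n⟩ -
    rcases Int.even_or_odd' (m + n) with ⟨c, hc | hc⟩
    · exact .inl ⟨(c, c - n), by simp only [Prod.mk.injEq]; omega⟩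
    · exact .inr ⟨(c, c - n), by simp only [Prod.mk.injEq]; omega⟩

/-! ### Growth of the quadratic exponents. -/

theorem two_mul_triangular (n : ℤ) : 2 * (n * (n - 1) / 2) = n * (n - 1) :=
  Int.mul_ediv_cancel' (Int.even_mul_pred_self n).two_dvd

theorem two_mul_pentagonal (n : ℤ) : 2 * (n * (3 * n - 1) / 2) = n * (3 * n - 1) := by
  rw [← natCast_pentagonal, two_mul_natCast_pentagonal]

theorem two_mul_pentagonal_neg (n : ℤ) : 2 * (n * (3 * n + 1) / 2) = n * (3 * n + 1) := by
  have h : n * (3 * n + 1) = -n * (3 * -n - 1) := by ring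
  rw [h, two_mul_pentagonal]

/-- A bound of this kind serves twice: only finitely many terms reach a given degree, and exponents
are non-negative, so `toNat` loses nothing. -/
theorem abs_le_theta_exponent {N A : ℤ} (hA : 0 < A) (hAN : 2 * A < N) (n : ℤ) :
    |n| ≤ N * (n * (n - 1) / 2) + A * n := by
  have h := two_mul_triangular n
  have h1 : 0 ≤ n * (n - 1) := by rcases le_or_gt n 0 with h | h <;> nlinarith
  have h2 : 0 ≤ n * (n + 1) := by rcases le_or_gt 0 n with h | h <;> nlinarith
  have h3 : n ≤ n * n := by nlinarith
  have h4 : -n ≤ n * n := by nlinarith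
  rw [abs_le]
  constructor <;> nlinarith

theorem abs_le_theta_two_exponent {N A : ℤ} (hA : 0 < A) (hAN : 2 * A < N) (n : ℤ) :
    |n| ≤ N * (n * (n - 1) / 2) + 2 * A * n := by
  have h := two_mul_triangular n
  have h1 : 0 ≤ n * (n - 1) := by rcases le_or_gt n 0 with h | h <;> nlinarith
  have h2 : 0 ≤ n * (n + 1) := by rcases le_or_gt 0 n with h | h <;> nlinarith
  rw [abs_le]
  constructor <;> nlinarith

theorem abs_le_quintuple_exponent {N A : ℤ} (hA : 0 < A) (hAN : 2 * A < N) (n : ℤ) :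
    |n| ≤ N * (n * (3 * n - 1) / 2) + 3 * A * n := by
  have h := two_mul_pentagonal n
  have h1 : 0 ≤ n * (n - 1) := by rcases le_or_gt n 0 with h | h <;> nlinarith
  have h2 : 0 ≤ n * (n + 1) := by rcases le_or_gt 0 n with h | h <;> nlinarith
  rw [abs_le]
  constructor <;> nlinarith

theorem abs_le_quintuple_exponent' {N A : ℤ} (hA : 0 < A) (hAN : 2 * A < N) (n : ℤ) :
    |n| ≤ N * (n * (3 * n + 1) / 2) + A * (3 * n + 1) := by
  have h := two_mul_pentagonal_neg n
  have h1 : 0 ≤ n * (n - 1) := by rcases le_or_gt n 0 with h | h <;> nlinarith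
  have h2 : 0 ≤ n * (n + 1) := by rcases le_or_gt 0 n with h | h <;> nlinarith
  have h3 : 0 ≤ (3 * n + 1) * (n + 1) := by rcases le_or_gt 0 n with h | h <;> nlinarith
  rw [abs_le]
  constructor <;> nlinarith

/-! ### Theta and Euler functions as sums of signed monomials. -/

theorem hasSum_theta {i j : ℕ} (hi : 0 < i) (hj : 0 < j) :
    HasSum (fun n : ℤ ↦ signedMonomial n ((i + j : ℤ) * (n * (n - 1) / 2) + i * n))
      (theta (-X ^ i) (-X ^ j)) := by
  refine (summable_theta hi hj).hasSum.congr_fun fun n ↦ ?_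
  have h := two_mul_triangular n
  have h' := two_mul_triangular (n + 1)
  rw [add_sub_cancel_right, mul_comm (n + 1)] at h'
  have h1 : 0 ≤ n * (n - 1) := by rcases le_or_gt n 0 with h | h <;> nlinarith
  have h2 : 0 ≤ n * (n + 1) := by rcases le_or_gt 0 n with h | h <;> nlinarith
  generalize n * (n - 1) / 2 = c at *
  obtain ⟨b, hb⟩ : ∃ b, n * (n + 1) / 2 = b := ⟨_, rfl⟩
  rw [hb] at h' ⊢
  lift b to ℕ using by omega
  lift c to ℕ using by omega
  have hbc : (b : ℤ) = c + n := by linarith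
  rw [signedMonomial, neg_pow, neg_pow (X ^ j), Int.toNat_natCast, Int.toNat_natCast, ← pow_mul,
    ← pow_mul, mul_mul_mul_comm, ← pow_add, ← pow_add]
  congr 1
  -- The signs agree because b - c = n has the parity of b + c.
  · rw [show n = ((b + c : ℕ) : ℤ) + 2 * (-c : ℤ) by push_cast; omega, Int.negOnePow_add,
      Int.negOnePow_even (2 * (-c : ℤ)) (even_two_mul _), mul_one, Int.negOnePow_def, zpow_natCast]
    simp
  · congr 1
    zify
    rw [Int.toNat_of_nonneg]
    · rw [hbc]
      ring
    · rw [show (i + j : ℤ) * c + i * n = i * b + j * c by rw [hbc]; ring]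
      positivity

theorem continuous_expand {N : ℕ} (hN : N ≠ 0) :
    Continuous (expand (R := ℤ) N hN) := by
  rw [continuous_iff_continuousAt]
  intro f
  rw [ContinuousAt, WithPiTopology.tendsto_iff_coeff_tendsto]
  intro d
  simp only [coeff_expand]
  split_ifs
  · exact (WithPiTopology.continuous_coeff ℤ _).tendsto f
  · exact tendsto_const_nhds

theorem euler_X_pow {N : ℕ} (hN : N ≠ 0) :
    euler (X ^ N) = expand N hN (pentagonalSeries ℤ) := by
  have h := (WithPiTopology.hasProd_one_sub_X_pow ℤ).map (expand N hN) (continuous_expand hN)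
  rw [euler, ← h.tprod_eq]
  simp

theorem hasSum_euler {N : ℕ} (hN : N ≠ 0) :
    HasSum (fun n : ℤ ↦ signedMonomial n (N * (n * (3 * n - 1) / 2))) (euler (X ^ N)) := by
  rw [euler_X_pow hN]
  convert (WithPiTopology.hasSum_pentagonalSeries ℤ).map (expand N hN) (continuous_expand hN)
    using 2 with n
  rw [← natCast_pentagonal, signedMonomial, Function.comp_apply, map_mul, map_pow, expand_X,
    ← pow_mul]
  congr 1
  simp

/-! ### The quintuple product identity. -/

/-- The two theta series whose sum is the series side of the quintuple product identity. -/
noncomputable def quintuple (N A : ℕ) : ℤ⟦X⟧ :=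
  (∑' b : ℤ, signedMonomial b (N * (b * (3 * b - 1) / 2) + 3 * A * b)) +
    ∑' b : ℤ, signedMonomial b (N * (b * (3 * b + 1) / 2) + A * (3 * b + 1))

theorem summable_quintuple_left {N A : ℕ} (hA : 0 < A) (hAN : 2 * A < N) :
    Summable fun b : ℤ ↦ signedMonomial b (N * (b * (3 * b - 1) / 2) + 3 * A * b) :=
  summable_signedMonomial _ _ (finite_setOf_le_of_abs_le fun n ↦
    abs_le_quintuple_exponent (by exact_mod_cast hA) (by exact_mod_cast hAN) n)

theorem summable_quintuple_right {N A : ℕ} (hA : 0 < A) (hAN : 2 * A < N) :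
    Summable fun b : ℤ ↦ signedMonomial b (N * (b * (3 * b + 1) / 2) + A * (3 * b + 1)) :=
  summable_signedMonomial _ _ (finite_setOf_le_of_abs_le fun n ↦
    abs_le_quintuple_exponent' (by exact_mod_cast hA) (by exact_mod_cast hAN) n)

theorem abs_le_pentagonal {N : ℤ} (hN : 0 < N) (n : ℤ) : |n| ≤ N * (n * (3 * n - 1) / 2) := by
  have h := two_mul_pentagonal n
  have h1 : 0 ≤ n * (n - 1) := by rcases le_or_gt n 0 with h | h <;> nlinarith
  have h2 : 0 ≤ n * (n + 1) := by rcases le_or_gt 0 n with h | h <;> nlinarith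
  have h3 : |n| ≤ n * (3 * n - 1) / 2 := by
    rw [abs_le]
    constructor <;> nlinarith
  nlinarith [abs_nonneg n]

/-- A form of the quintuple product identity. -/
theorem theta_mul_euler {N A : ℕ} (hA : 0 < A) (hAN : 2 * A < N) :
    theta (-X ^ (2 * A)) (-X ^ (N - 2 * A)) * euler (X ^ N) =
      theta (-X ^ A) (-X ^ (N - A)) * quintuple N A := by
  have hA' : (0 : ℤ) < A := by exact_mod_cast hA
  have hAN' : 2 * (A : ℤ) < N := by exact_mod_cast hAN
  have hθ : HasSum (fun n : ℤ ↦ signedMonomial n (N * (n * (n - 1) / 2) + A * n))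
      (theta (-X ^ A) (-X ^ (N - A))) := by
    convert hasSum_theta hA (show 0 < N - A by omega) using 5
    omega
  have hθ' : HasSum (fun n : ℤ ↦ signedMonomial n (N * (n * (n - 1) / 2) + 2 * A * n))
      (theta (-X ^ (2 * A)) (-X ^ (N - 2 * A))) := by
    convert hasSum_theta (show 0 < 2 * A by omega) (show 0 < N - 2 * A by omega) using 5
    · omega
    · push_cast
      ring
  have hL := hasSum_signedMonomial_mul (abs_le_theta_two_exponent hA' hAN')
    (abs_le_pentagonal (by omega)) hθ' (hasSum_euler (show N ≠ 0 by omega))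
  have hR := hasSum_signedMonomial_mul (abs_le_theta_exponent hA' hAN')
    (abs_le_quintuple_exponent hA' hAN') hθ (summable_quintuple_left hA hAN).hasSum
  have hR' := hasSum_signedMonomial_mul (abs_le_theta_exponent hA' hAN')
    (abs_le_quintuple_exponent' hA' hAN') hθ (summable_quintuple_right hA hAN).hasSum
  have hinj : Function.Injective fun u : ℤ × ℤ ↦ (u.1 + u.2, u.1 - u.2) := by
    rintro ⟨u, v⟩ ⟨u', v'⟩ h
    simp only [Prod.mk.injEq] at h ⊢
    omega
  have hinj' : Function.Injective fun u : ℤ × ℤ ↦ (u.1 + u.2 + 1, u.1 - u.2) := by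
    rintro ⟨u, v⟩ ⟨u', v'⟩ h
    simp only [Prod.mk.injEq] at h ⊢
    omega
  -- Split each double sum by the parity of the sum of its indices. Let a, b be the even and odd
  -- parts of theta times the first half of `quintuple`, and c the odd part of theta times the
  -- second half. By `σ` the even part of the latter is -b, so the right side is a + c; `τ` and `ρ`
  -- match a and c with the even and odd parts of the left side.
  have ha := (hR.summable.comp_injective hinj).hasSum
  have hb := (hR.summable.comp_injective hinj').hasSum
  have hc := (hR'.summable.comp_injective hinj').hasSum
  let σ : ℤ × ℤ ≃ ℤ × ℤ :=
    { toFun u := (u.1 - u.2, -u.2)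
      invFun u := (u.1 - u.2, -u.2)
      left_inv u := by ext <;> simp
      right_inv u := by ext <;> simp }
  let τ : ℤ × ℤ ≃ ℤ × ℤ :=
    { toFun u := (u.1, u.1 - u.2)
      invFun u := (u.1, u.1 - u.2)
      left_inv u := by ext <;> simp
      right_inv u := by ext <;> simp }
  let ρ : ℤ × ℤ ≃ ℤ × ℤ :=
    { toFun u := (u.1 - u.2, u.1)
      invFun u := (u.2, u.2 - u.1)
      left_inv u := by ext <;> simp
      right_inv u := by ext <;> simp }
  have hb' := hb.neg
  rw [← σ.hasSum_iff] at hb'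
  have h1 := hR.unique (hasSum_of_parity ha hb)
  have h2 := hR'.unique (hasSum_of_parity (hb'.congr_fun fun ⟨u, v⟩ ↦ by
    refine signedMonomial_eq_neg ⟨v - 1, by dsimp [σ]; ring⟩ (mul_left_cancel₀ two_ne_zero ?_)
    dsimp [σ, τ, ρ]
    linear_combination (N : ℤ) * (two_mul_triangular (u + v) + two_mul_pentagonal_neg (u - v) -
      two_mul_triangular (u - v + -v + 1) - two_mul_pentagonal (u - v - -v))) hc)
  have h3 := hL.unique (hasSum_of_parity (τ.hasSum_iff.mp (ha.congr_fun fun ⟨u, v⟩ ↦ by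
    refine signedMonomial_congr ⟨0, by dsimp [τ]; ring⟩ (mul_left_cancel₀ two_ne_zero ?_)
    dsimp [σ, τ, ρ]
    linear_combination (N : ℤ) * (two_mul_triangular (u + (u - v)) +
      two_mul_pentagonal (u - (u - v)) - two_mul_triangular (u + v) - two_mul_pentagonal (u - v)))) (ρ.hasSum_iff.mp (hc.congr_fun fun ⟨u, v⟩ ↦ by
    refine signedMonomial_congr ⟨-v, by dsimp [ρ]; ring⟩ (mul_left_cancel₀ two_ne_zero ?_)
    dsimp [σ, τ, ρ]
    linear_combination (N : ℤ) * (two_mul_triangular (u - v + u + 1) +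
      two_mul_pentagonal (u - v - u) - two_mul_triangular (u + v + 1) -
      two_mul_pentagonal_neg (u - v)))))
  rw [h3, quintuple, mul_add, h1, h2]
  ring

/-! ### Dissection by residues of exponents. -/

/-- The power series `∑ k, a (N * k + p) * X ^ k`, where `a n` are the coefficients of the given
series. -/
noncomputable def dissection (N p : ℕ) : ℤ⟦X⟧ →+ ℤ⟦X⟧ where
  toFun f := mk fun k ↦ coeff (N * k + p) f
  map_zero' := by ext; simp
  map_add' f g := by ext; simp

@[simp]
theorem coeff_dissection (N p k : ℕ) (f : ℤ⟦X⟧) :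
    coeff k (dissection N p f) = coeff (N * k + p) f :=
  coeff_mk k fun k ↦ coeff (N * k + p) f

theorem continuous_dissection (N p : ℕ) : Continuous (dissection N p) := by
  rw [continuous_iff_continuousAt]
  intro f
  rw [ContinuousAt, WithPiTopology.tendsto_iff_coeff_tendsto]
  intro d
  simp only [coeff_dissection]
  exact (WithPiTopology.continuous_coeff ℤ _).tendsto f

theorem dissection_sum_expand {N : ℕ} (hN : N ≠ 0) (J : Fin N → ℤ⟦X⟧) (p : Fin N) :
    dissection N p (∑ r : Fin N, X ^ (r : ℕ) * expand N hN (J r)) = J p := by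
  ext k
  rw [coeff_dissection, map_sum, Finset.sum_eq_single p]
  · rw [coeff_X_pow_mul', if_pos (Nat.le_add_left _ _), Nat.add_sub_cancel, coeff_expand_mul]
  · intro r _ hr
    rw [coeff_X_pow_mul']
    split_ifs with h
    · refine coeff_expand_of_not_dvd N hN _ fun hd ↦ hr (Fin.ext ?_)
      have h1 : (r : ℕ) ≡ N * k + p [MOD N] := (Nat.modEq_iff_dvd' h).mpr hd
      have h2 : (r : ℕ) % N = (N * k + p) % N := h1
      rwa [Nat.mul_add_mod, Nat.mod_eq_of_lt r.2, Nat.mod_eq_of_lt p.2] at h2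
    · rfl
  · simp

theorem sum_expand_dissection {N : ℕ} (hN : N ≠ 0) (f : ℤ⟦X⟧) :
    ∑ r : Fin N, X ^ (r : ℕ) * expand N hN (dissection N r f) = f := by
  ext n
  have hp : n % N < N := Nat.mod_lt n (Nat.pos_of_ne_zero hN)
  have h := congr_arg (coeff (n / N))
    (dissection_sum_expand hN (fun r ↦ dissection N r f) ⟨n % N, hp⟩)
  simpa only [coeff_dissection, Nat.div_add_mod] using h

theorem euler_X : euler X = pentagonalSeries ℤ :=
  WithPiTopology.tprod_one_sub_X_pow ℤ

theorem isExpansion_iff {N : ℕ} (hN : N ≠ 0) (J : Fin N → ℤ⟦X⟧) :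
    IsExpansion N J ↔
      ∀ p : Fin N, J p = quot (dissection N p (euler X)) (euler (X ^ N)) := by
  have hN0 := Nat.pos_of_ne_zero hN
  have hu := isUnit_euler hN0
  -- The denominator is the image of a unit under `expand`, so its inverse is a series in X ^ N too
  -- and factors out of every component.
  have hu' : expand N hN (Ring.inverse (euler (X ^ N))) = Ring.inverse (euler ((X ^ N) ^ N)) := by
    have h1 : expand N hN (euler (X ^ N)) = euler ((X ^ N) ^ N) := by
      rw [← pow_mul, euler_X_pow hN, euler_X_pow (mul_ne_zero hN hN), expand_mul]
    have h2 : IsUnit (euler ((X ^ N) ^ N)) := h1 ▸ hu.map (expand N hN)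
    refine h2.mul_left_cancel ?_
    rw [Ring.mul_inverse_cancel _ h2, ← h1, ← map_mul, Ring.mul_inverse_cancel _ hu, map_one]
  have key : quot (euler X) (euler ((X ^ N) ^ N)) = ∑ r : Fin N, X ^ (r : ℕ) *
      expand N hN (quot (dissection N r (euler X)) (euler (X ^ N))) := by
    simp only [quot, map_mul, hu', ← mul_assoc]
    rw [← Finset.sum_mul, sum_expand_dissection]
  simp only [IsExpansion, ← expand_apply N hN]
  constructor
  · intro h p
    rw [← dissection_sum_expand hN J p, ← h, key, dissection_sum_expand]
  · intro h
    simp only [h, key]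

theorem dissection_signedMonomial {N p : ℕ} (hp : p < N) {k e c : ℤ} (hc : 0 ≤ c)
    (he : e = p + N * c) : dissection N p (signedMonomial k e) = signedMonomial k c := by
  lift c to ℕ using hc
  ext d
  have h : e.toNat = p + N * c := by rw [he]; exact_mod_cast Int.toNat_natCast _
  rw [coeff_dissection, coeff_signedMonomial, coeff_signedMonomial, h, Int.toNat_natCast]
  congr 1
  rw [add_comm, Nat.add_left_cancel_iff, Nat.mul_right_inj (by omega)]

theorem dissection_signedMonomial_eq_zero {N p : ℕ} {k e : ℤ} (he0 : 0 ≤ e)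
    (he : ¬ (N : ℤ) ∣ e - p) : dissection N p (signedMonomial k e) = 0 := by
  ext d
  rw [coeff_dissection, coeff_signedMonomial, if_neg, map_zero]
  rintro h
  refine he ⟨d, ?_⟩
  zify at h
  rw [Int.toNat_of_nonneg he0] at h
  rw [← h]
  ring

theorem hasSum_dissection_euler (N p : ℕ) :
    HasSum (fun n : ℤ ↦ dissection N p (signedMonomial n (n * (3 * n - 1) / 2)))
      (dissection N p (euler X)) := by
  have h := (hasSum_euler one_ne_zero).map (dissection N p) (continuous_dissection N p)
  simpa [Function.comp_def] using h

/-! ### Pentagonal numbers modulo N. -/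

theorem twentyfour_mul_pentagonal (k : ℤ) :
    24 * (k * (3 * k - 1) / 2) = (6 * k - 1) ^ 2 - 1 := by
  linear_combination 12 * two_mul_pentagonal k

/-- The exponent `((N - 6 A) ^ 2 - 1) / 24`, an integer for `N` coprime to `6`. -/
def leadingExponent (N A : ℤ) : ℤ :=
  ((N - 6 * A) ^ 2 - 1) / 24

theorem twentyfour_mul_leadingExponent {N j s : ℤ} (hs : s = 1 ∨ s = -1) (hN : N = 6 * j + s)
    (A : ℤ) : 24 * leadingExponent N A = (N - 6 * A) ^ 2 - 1 := by
  -- The quotient is itself pentagonal: k = s(A - j) gives 6k - 1 = s(6A - N).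
  refine Int.mul_ediv_cancel' ⟨(s * (A - j)) * (3 * (s * (A - j)) - 1) / 2, ?_⟩
  rw [twentyfour_mul_pentagonal, hN]
  rcases hs with rfl | rfl <;> ring

theorem leadingExponent_nonneg {N j s : ℤ} (hs : s = 1 ∨ s = -1) (hN : N = 6 * j + s)
    (A : ℤ) : 0 ≤ leadingExponent N A := by
  refine Int.ediv_nonneg ?_ (by norm_num)
  have : N - 6 * A ≠ 0 := by omega
  have : 0 < (N - 6 * A) ^ 2 := by positivity
  omega

theorem isCoprime_six {N j s : ℤ} (hs : s = 1 ∨ s = -1) (hN : N = 6 * j + s) : IsCoprime N 6 :=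
  ⟨s, -s * j, by rcases hs with rfl | rfl <;> rw [hN] <;> ring⟩

/-- Both 24 and 36 are units modulo N; the converse cancels 6³ = 9 · 24. -/
theorem dvd_iff_of_mul_eq {N x y z : ℤ} (h6 : IsCoprime N 6)
    (h : 24 * x = 36 * y + N * z) : N ∣ x ↔ N ∣ y := by
  constructor
  · rintro ⟨c, hc⟩
    refine (h6.pow_right (n := 2)).dvd_of_dvd_mul_left ⟨24 * c - z, ?_⟩
    linear_combination 24 * hc - h
  · rintro ⟨c, hc⟩
    refine (h6.pow_right (n := 3)).dvd_of_dvd_mul_left ⟨9 * (36 * c + z), ?_⟩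
    linear_combination 9 * h + 324 * hc

/-- Since 6sj = sN - 1, 6k - 1 ≡ 6(k + sj) mod N, and a difference of squares factors. -/
theorem dvd_pentagonal_sub_iff {N j s : ℤ} (hs : s = 1 ∨ s = -1) (hN : N = 6 * j + s) (A k : ℤ) :
    N ∣ k * (3 * k - 1) / 2 - leadingExponent N A ↔
      N ∣ (k + s * j - A) * (k + s * j + A) := by
  refine dvd_iff_of_mul_eq (isCoprime_six hs hN) (z := 12 * (A - s * (k + s * j))) ?_
  rw [mul_sub, twentyfour_mul_pentagonal, twentyfour_mul_leadingExponent hs hN, hN]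
  rcases hs with rfl | rfl <;> ring

theorem dvd_leadingExponent_sub_iff {N j s : ℤ} (hs : s = 1 ∨ s = -1) (hN : N = 6 * j + s)
    (A B : ℤ) :
    N ∣ leadingExponent N A - leadingExponent N B ↔ N ∣ (A - B) * (A + B) := by
  refine dvd_iff_of_mul_eq (isCoprime_six hs hN) (z := 12 * (B - A)) ?_
  rw [mul_sub, twentyfour_mul_leadingExponent hs hN, twentyfour_mul_leadingExponent hs hN]
  ring

/-- On this progression 6k - 1 = s(N(6b - 1) + 6A); on that of `pentagonal_right` it is -s(N(6b + 1)
+ 6A). -/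
theorem pentagonal_left {N j s : ℤ} (hs : s = 1 ∨ s = -1) (hN : N = 6 * j + s) (A b : ℤ) :
    s * (b * N - j + A) * (3 * (s * (b * N - j + A)) - 1) / 2 =
      leadingExponent N A + N * (N * (b * (3 * b - 1) / 2) + 3 * A * b) := by
  refine mul_left_cancel₀ (show (24 : ℤ) ≠ 0 by norm_num) ?_
  rw [twentyfour_mul_pentagonal, mul_add 24, twentyfour_mul_leadingExponent hs hN]
  trans (N - 6 * A) ^ 2 - 1 + N * (N * ((6 * b - 1) ^ 2 - 1) + 72 * A * b)
  · rw [hN]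
    rcases hs with rfl | rfl <;> ring
  · rw [← twentyfour_mul_pentagonal]
    ring

theorem pentagonal_right {N j s : ℤ} (hs : s = 1 ∨ s = -1) (hN : N = 6 * j + s) (A b : ℤ) :
    -s * (b * N + j + A) * (3 * (-s * (b * N + j + A)) - 1) / 2 =
      leadingExponent N A + N * (N * (b * (3 * b + 1) / 2) + A * (3 * b + 1)) := by
  refine mul_left_cancel₀ (show (24 : ℤ) ≠ 0 by norm_num) ?_
  rw [twentyfour_mul_pentagonal, mul_add 24, twentyfour_mul_leadingExponent hs hN]
  trans (N - 6 * A) ^ 2 - 1 + N * (12 * N * (b * (3 * b + 1)) + 24 * A * (3 * b + 1))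
  · rw [hN]
    rcases hs with rfl | rfl <;> ring
  · linear_combination -(12 * N ^ 2) * two_mul_pentagonal_neg b

theorem exists_dvd_pentagonal_sub {N : ℕ} {j s : ℤ} (hs : s = 1 ∨ s = -1)
    (hN : (N : ℤ) = 6 * j + s) (hN0 : 0 < N) (k : ℤ) : ∃ A : ℕ, A ≤ (N - 1) / 2 ∧
      (N : ℤ) ∣ k * (3 * k - 1) / 2 - leadingExponent N A := by
  simp only [dvd_pentagonal_sub_iff hs hN]
  have h0 : (0 : ℤ) < N := by exact_mod_cast hN0
  have h1 := Int.emod_nonneg (k + s * j) h0.ne'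
  have h2 := Int.emod_lt_of_pos (k + s * j) h0
  have h3 := Int.emod_add_mul_ediv (k + s * j) N
  generalize (k + s * j) % N = r at *
  generalize (k + s * j) / N = q at *
  lift r to ℕ using h1
  rw [← h3]
  by_cases hr : r ≤ (N - 1) / 2
  · exact ⟨r, hr, dvd_mul_of_dvd_left ⟨q, by ring⟩ _⟩
  -- Only ±A matters, so a residue above (N-1)/2 is replaced by its negative.
  · refine ⟨N - r, by omega, dvd_mul_of_dvd_right ⟨q + 1, ?_⟩ _⟩
    rw [Nat.cast_sub (by omega)]
    ring

theorem eq_left_or_right_of_dvd {N : ℕ} (hP : N.Prime) {j s : ℤ} (hs : s = 1 ∨ s = -1)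
    (hN : (N : ℤ) = 6 * j + s) {A k : ℤ}
    (h : (N : ℤ) ∣ k * (3 * k - 1) / 2 - leadingExponent N A) :
    (∃ b, s * (b * N - j + A) = k) ∨ ∃ b, -s * (b * N + j + A) = k := by
  rw [dvd_pentagonal_sub_iff hs hN] at h
  rcases (Nat.prime_iff_prime_int.mp hP).dvd_or_dvd h with ⟨c, hc⟩ | ⟨c, hc⟩ <;>
    rcases hs with rfl | rfl
  · exact .inl ⟨c, by linear_combination -hc⟩
  · exact .inr ⟨c, by linear_combination -hc⟩
  · exact .inr ⟨-c, by linear_combination -hc⟩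
  · exact .inl ⟨-c, by linear_combination -hc⟩

/-- Both N and s are odd, so the sign is (-1)^(j + A) times the sign (-1)^b of the theta series. -/
theorem even_left {N j s : ℤ} (hs : s = 1 ∨ s = -1) (hN : N = 6 * j + s) (A b : ℤ) :
    Even (s * (b * N - j + A) - (j + A + b)) := by
  rcases hs with rfl | rfl
  · exact ⟨3 * b * j - j, by rw [hN]; ring⟩
  · exact ⟨-3 * b * j - A, by rw [hN]; ring⟩

theorem even_right {N j s : ℤ} (hs : s = 1 ∨ s = -1) (hN : N = 6 * j + s) (A b : ℤ) :
    Even (-s * (b * N + j + A) - (j + A + b)) := by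
  rcases hs with rfl | rfl
  · exact ⟨-3 * b * j - j - A - b, by rw [hN]; ring⟩
  · exact ⟨3 * b * j - b, by rw [hN]; ring⟩

/-! ### Components of the Euler function. -/

theorem dissection_euler_eq_zero {N : ℕ} {p : ℕ}
    (h : ∀ k : ℤ, ¬ (N : ℤ) ∣ k * (3 * k - 1) / 2 - p) : dissection N p (euler X) = 0 := by
  refine (hasSum_dissection_euler N p).unique (hasSum_zero.congr_fun fun k ↦ ?_)
  refine dissection_signedMonomial_eq_zero ?_ (h k)
  exact (abs_nonneg k).trans (by simpa using abs_le_pentagonal one_pos k)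

theorem dissection_pentagonal_eq_zero {N : ℕ} (hP : N.Prime) {j s : ℤ} (hs : s = 1 ∨ s = -1)
    (hN : (N : ℤ) = 6 * j + s) {A c k : ℤ} {p : ℕ} (hc : leadingExponent N A = p + N * c)
    (hk : dissection N p (signedMonomial k (k * (3 * k - 1) / 2)) ≠ 0) :
    (∃ b, s * (b * N - j + A) = k) ∨ ∃ b, -s * (b * N + j + A) = k := by
  refine eq_left_or_right_of_dvd hP hs hN ?_
  by_contra h
  refine hk (dissection_signedMonomial_eq_zero ?_ fun ⟨d, hd⟩ ↦ h ⟨d - c, ?_⟩)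
  · exact (abs_nonneg k).trans (by simpa using abs_le_pentagonal one_pos k)
  · linear_combination hd - hc

theorem dissection_left {N p : ℕ} (hp : p < N) {j s : ℤ} (hs : s = 1 ∨ s = -1)
    (hN : (N : ℤ) = 6 * j + s) {A c : ℤ} (hc0 : 0 ≤ c) (hc : leadingExponent N A = p + N * c)
    {b : ℤ} (hb : 0 ≤ N * (b * (3 * b - 1) / 2) + 3 * A * b) :
    dissection N p (signedMonomial (s * (b * N - j + A))
      (s * (b * N - j + A) * (3 * (s * (b * N - j + A)) - 1) / 2)) =
      signedMonomial (j + A) c * signedMonomial b (N * (b * (3 * b - 1) / 2) + 3 * A * b) := by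
  rw [signedMonomial_mul hc0 hb, dissection_signedMonomial hp (add_nonneg hc0 hb)]
  · exact signedMonomial_congr (even_left hs hN A b) rfl
  · rw [pentagonal_left hs hN, hc]
    ring

theorem dissection_right {N p : ℕ} (hp : p < N) {j s : ℤ} (hs : s = 1 ∨ s = -1)
    (hN : (N : ℤ) = 6 * j + s) {A c : ℤ} (hc0 : 0 ≤ c) (hc : leadingExponent N A = p + N * c)
    {b : ℤ} (hb : 0 ≤ N * (b * (3 * b + 1) / 2) + A * (3 * b + 1)) :
    dissection N p (signedMonomial (-s * (b * N + j + A))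
      (-s * (b * N + j + A) * (3 * (-s * (b * N + j + A)) - 1) / 2)) =
      signedMonomial (j + A) c *
        signedMonomial b (N * (b * (3 * b + 1) / 2) + A * (3 * b + 1)) := by
  rw [signedMonomial_mul hc0 hb, dissection_signedMonomial hp (add_nonneg hc0 hb)]
  · exact signedMonomial_congr (even_right hs hN A b) rfl
  · rw [pentagonal_right hs hN, hc]
    ring

theorem dissection_euler_zero {N p : ℕ} (hP : N.Prime) (hp : p < N) {j s : ℤ}
    (hs : s = 1 ∨ s = -1) (hN : (N : ℤ) = 6 * j + s) {c : ℤ} (hc0 : 0 ≤ c)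
    (hc : leadingExponent N 0 = p + N * c) :
    dissection N p (euler X) = signedMonomial j c * euler (X ^ N) := by
  have hN0 : N ≠ 0 := hP.ne_zero
  have hs0 : s ≠ 0 := by omega
  have hi : Function.Injective fun b : ℤ ↦ s * (b * N - j + 0) := fun b b' h ↦ by
    simpa [hs0, hN0] using h
  refine (hasSum_dissection_euler N p).unique ((hi.hasSum_iff fun k hk ↦ ?_).mp
    (((hasSum_euler hP.ne_zero).mul_left (signedMonomial j c)).congr_fun fun b ↦ ?_))
  · by_contra h
    rcases dissection_pentagonal_eq_zero hP hs hN hc h with h | ⟨b, rfl⟩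
    · exact hk h
    -- For A = 0 the two progressions coincide under b ↦ -b.
    · exact hk ⟨-b, by ring⟩
  · have hb : 0 ≤ (N : ℤ) * (b * (3 * b - 1) / 2) + 3 * 0 * b := by
      simpa using (abs_nonneg b).trans (abs_le_pentagonal (by positivity) b)
    simpa using dissection_left hp hs hN hc0 hc hb

theorem dissection_euler_pos {N p : ℕ} (hP : N.Prime) (hp : p < N) {j s : ℤ}
    (hs : s = 1 ∨ s = -1) (hN : (N : ℤ) = 6 * j + s) {A : ℕ} (hA : 0 < A) (hAN : 2 * A < N)
    {c : ℤ} (hc0 : 0 ≤ c) (hc : leadingExponent N A = p + N * c) :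
    dissection N p (euler X) = signedMonomial (j + A) c * quintuple N A := by
  have hA' : (0 : ℤ) < A := by exact_mod_cast hA
  have hAN' : 2 * (A : ℤ) < N := by exact_mod_cast hAN
  have hN0 : N ≠ 0 := hP.ne_zero
  have hs0 : s ≠ 0 := by omega
  rw [quintuple, mul_add]
  refine (hasSum_dissection_euler N p).unique (hasSum_of_disjoint_ranges
    (i := fun b : ℤ ↦ s * (b * N - j + A)) (j := fun b : ℤ ↦ -s * (b * N + j + A)) ?_ ?_ ?_
    (fun k hk ↦ dissection_pentagonal_eq_zero hP hs hN hc hk)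
    (((summable_quintuple_left hA hAN).hasSum.mul_left _).congr_fun fun b ↦ ?_)
    (((summable_quintuple_right hA hAN).hasSum.mul_left _).congr_fun fun b ↦ ?_))
  · intro b b' h
    simpa [hs0, hN0] using h
  · intro b b' h
    simpa [hs0, hN0] using h
  · intro b b' h
    -- A common index would make 2A a multiple of N, but 0 < 2A < N.
    have h1 : s * ((b + b') * N + 2 * A) = 0 := by linear_combination h
    have h2 : (b + b') * N + 2 * A = 0 := by simpa [hs0] using h1
    rcases le_or_gt 0 (b + b') with h | h <;> nlinarith
  · exact dissection_left hp hs hN hc0 hc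
      ((abs_nonneg b).trans (abs_le_quintuple_exponent hA' hAN' b))
  · exact dissection_right hp hs hN hc0 hc
      ((abs_nonneg b).trans (abs_le_quintuple_exponent' hA' hAN' b))

/-! ### Closed forms and the count of non-zero components. -/

theorem quot_mul_eq {a b x y m : ℤ⟦X⟧} (hy : IsUnit y) (hb : IsUnit b) (h : x * b = y * a) :
    quot (m * a) b = m * quot x y := by
  refine hb.mul_right_cancel (hy.mul_right_cancel ?_)
  calc m * a * Ring.inverse b * b * y = m * (y * a) * (b * Ring.inverse b) := by ring
    _ = m * (x * b) * (y * Ring.inverse y) := by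
      rw [Ring.mul_inverse_cancel _ hb, Ring.mul_inverse_cancel _ hy, h]
    _ = m * (x * Ring.inverse y) * b * y := by ring

theorem signedMonomial_natCast (k : ℕ) (c : ℤ) :
    signedMonomial k c = (-1) ^ k * X ^ c.toNat := by
  simp [signedMonomial, Int.negOnePow_def]

theorem leadingExponent_eq_add {N p : ℕ} (hp : p < N) {A : ℤ}
    (h : (p : ℤ) ≡ leadingExponent N A [ZMOD N]) :
    leadingExponent N A = p + N * (((N - 6 * A) ^ 2 - 1) / (24 * (N : ℤ))) := by
  rw [← Int.ediv_ediv_of_nonneg (by norm_num), ← leadingExponent]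
  have h1 : (p : ℤ) % N = leadingExponent N A % N := h
  rw [Int.emod_eq_of_lt (by positivity) (by exact_mod_cast hp)] at h1
  rw [h1, Int.emod_add_mul_ediv]

/-- Fixes j = ⌊(N+1)/6⌋, the source of the sign exponent in the final formulas. -/
theorem exists_eq_six_mul_add {N : ℕ} (hP : N.Prime) (hN3 : 3 < N) :
    ∃ s : ℤ, (s = 1 ∨ s = -1) ∧ (N : ℤ) = 6 * ((N + 1) / 6 : ℕ) + s := by
  have h2 : ¬ 2 ∣ N := fun h ↦ by have := (Nat.prime_dvd_prime_iff_eq Nat.prime_two hP).mp h; omega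
  have h3 : ¬ 3 ∣ N := fun h ↦ by
    have := (Nat.prime_dvd_prime_iff_eq Nat.prime_three hP).mp h; omega
  exact ⟨(N : ℤ) - 6 * ((N + 1) / 6 : ℕ), by omega, by ring⟩

theorem ncard_setOf_exists_leadingExponent {N : ℕ} (hP : N.Prime) {j s : ℤ}
    (hs : s = 1 ∨ s = -1) (hN : (N : ℤ) = 6 * j + s) :
    {p : Fin N | ∃ A : ℕ, A ≤ (N - 1) / 2 ∧
      ((p : ℕ) : ℤ) ≡ leadingExponent N A [ZMOD N]}.ncard = (N + 1) / 2 := by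
  have hN0 := hP.pos
  have hNZ : (0 : ℤ) < N := by exact_mod_cast hN0
  have hlt (A : ℕ) : (leadingExponent N A % N).toNat < N := by
    have := Int.emod_lt_of_pos (leadingExponent N A) hNZ
    omega
  have himage : {p : Fin N | ∃ A : ℕ, A ≤ (N - 1) / 2 ∧
      ((p : ℕ) : ℤ) ≡ leadingExponent N A [ZMOD N]} =
      (fun A : ℕ ↦ (⟨_, hlt A⟩ : Fin N)) '' (Finset.range ((N - 1) / 2 + 1) : Set ℕ) := by
    ext p
    simp only [Set.mem_ofPred_eq, Set.mem_image, Finset.coe_range, Set.mem_Iio, Nat.lt_succ_iff,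
      Fin.ext_iff]
    refine exists_congr fun A ↦ and_congr_right fun _ ↦ ?_
    have hp := p.2
    have h1 := Int.emod_nonneg (leadingExponent N A) hNZ.ne'
    rw [Int.ModEq, Int.emod_eq_of_lt (by positivity) (by exact_mod_cast hp)]
    omega
  rw [himage, Set.InjOn.ncard_image, Set.ncard_coe_finset, Finset.card_range]
  · omega
  · intro A hA B hB hAB
    simp only [Finset.coe_range, Set.mem_Iio] at hA hB
    simp only [Fin.mk.injEq] at hAB
    have h1 := Int.emod_nonneg (leadingExponent N A) hNZ.ne'
    have h2 := Int.emod_nonneg (leadingExponent N B) hNZ.ne'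
    have h3 : leadingExponent N A % N = leadingExponent N B % N := by omega
    have h4 := (dvd_leadingExponent_sub_iff hs hN _ _).mp
      (Int.dvd_of_emod_eq_zero (Int.emod_eq_emod_iff_emod_sub_eq_zero.mp h3))
    -- Both |A - B| and A + B are below N, so the factor divisible by N is zero, and either way A =
    -- B.
    rcases (Nat.prime_iff_prime_int.mp hP).dvd_or_dvd h4 with h | h
    · have := Int.eq_zero_of_abs_lt_dvd h (by rw [abs_lt]; omega)
      omega
    · have := Int.eq_zero_of_abs_lt_dvd h (by rw [abs_lt]; omega)
      omega

theorem dissection_quot_of_zero {N p : ℕ} (hP : N.Prime) (hN3 : 3 < N) (hp : p < N)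
    (h : (p : ℤ) ≡ leadingExponent N 0 [ZMOD N]) :
    quot (dissection N p (euler X)) (euler (X ^ N)) =
      (-1) ^ ((N + 1) / 6) * X ^ ((N ^ 2 - 1) / (24 * N)) := by
  obtain ⟨s, hs, hN⟩ := exists_eq_six_mul_add hP hN3
  have hc := leadingExponent_eq_add hp h
  have hcast : ((N : ℤ) - 6 * 0) ^ 2 - 1 = ((N ^ 2 - 1 : ℕ) : ℤ) := by
    rw [Nat.cast_sub (Nat.one_le_pow _ _ hP.pos)]
    push_cast
    ring
  rw [hcast] at hc
  rw [dissection_euler_zero hP hp hs hN (by positivity) hc, signedMonomial_natCast, quot,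
    mul_assoc, Ring.mul_inverse_cancel _ (isUnit_euler hP.pos), mul_one]
  congr 2

theorem dissection_quot_of_pos {N p A : ℕ} (hP : N.Prime) (hN3 : 3 < N) (hp : p < N)
    (hA : 0 < A) (hAN : A ≤ (N - 1) / 2) (h : (p : ℤ) ≡ leadingExponent N A [ZMOD N]) :
    quot (dissection N p (euler X)) (euler (X ^ N)) =
      (-1) ^ (A + (N + 1) / 6) *
        X ^ ((((N : ℤ) - 6 * (A : ℤ)) ^ 2 - 1) / (24 * (N : ℤ))).toNat *
        quot (theta (-(X ^ (2 * A))) (-(X ^ (N - 2 * A)))) (theta (-(X ^ A)) (-(X ^ (N - A)))) := by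
  obtain ⟨s, hs, hN⟩ := exists_eq_six_mul_add hP hN3
  have hc := leadingExponent_eq_add hp h
  have hAN' : 2 * A < N := by omega
  have hc0 : 0 ≤ (((N : ℤ) - 6 * A) ^ 2 - 1) / (24 * (N : ℤ)) := by
    rw [← Int.ediv_ediv_of_nonneg (by norm_num)]
    exact Int.ediv_nonneg (leadingExponent_nonneg hs hN A) (by positivity)
  rw [dissection_euler_pos hP hp hs hN hA hAN' hc0 hc, ← Nat.cast_add, signedMonomial_natCast,
    add_comm A]
  exact quot_mul_eq (isUnit_theta hA (by omega)) (isUnit_euler hP.pos) (theta_mul_euler hA hAN')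

theorem isUnit_quot {f g : ℤ⟦X⟧} (hf : IsUnit f) (hg : IsUnit g) : IsUnit (quot f g) :=
  hf.mul hg.ringInverse

end RamanujanJ

open RamanujanJ in
theorem theorem1 (N : ℕ) (hN : N.Prime) (hN3 : 3 < N) :
    (∃! J : Fin N → PowerSeries ℤ, RamanujanJ.IsExpansion N J) ∧
    ∀ J : Fin N → PowerSeries ℤ, RamanujanJ.IsExpansion N J →
      -- (I)
      {p : Fin N | J p ≠ 0}.ncard = (N + 1) / 2 ∧
      (∀ p : Fin N, J p ≠ 0 ↔
        ∃ A : ℕ, A ≤ (N - 1) / 2 ∧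
          ((p : ℕ) : ℤ) ≡ (((N : ℤ) - 6 * (A : ℤ)) ^ 2 - 1) / 24 [ZMOD (N : ℤ)]) ∧
      -- (II)
      (∀ p : Fin N, ((p : ℕ) : ℤ) ≡ ((N : ℤ) ^ 2 - 1) / 24 [ZMOD (N : ℤ)] →
        J p = (-1) ^ ((N + 1) / 6) * PowerSeries.X ^ ((N ^ 2 - 1) / (24 * N))) ∧
      -- (III)
      (∀ A : ℕ, 0 < A → A ≤ (N - 1) / 2 → ∀ p : Fin N,
        ((p : ℕ) : ℤ) ≡ (((N : ℤ) - 6 * (A : ℤ)) ^ 2 - 1) / 24 [ZMOD (N : ℤ)] →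
        J p = (-1) ^ (A + (N + 1) / 6) *
          PowerSeries.X ^ ((((N : ℤ) - 6 * (A : ℤ)) ^ 2 - 1) / (24 * (N : ℤ))).toNat *
          RamanujanJ.quot
            (RamanujanJ.theta (-(PowerSeries.X ^ (2 * A))) (-(PowerSeries.X ^ (N - 2 * A))))
            (RamanujanJ.theta (-(PowerSeries.X ^ A)) (-(PowerSeries.X ^ (N - A))))) := by
  simp only [isExpansion_iff hN.ne_zero]
  refine ⟨⟨_, fun p ↦ rfl, fun J hJ ↦ funext hJ⟩, fun J hJ ↦ ?_⟩
  obtain ⟨s, hs, hNs⟩ := exists_eq_six_mul_add hN hN3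
  have hII (p : Fin N) (hp : ((p : ℕ) : ℤ) ≡ leadingExponent N 0 [ZMOD N]) :=
    (hJ p).trans (dissection_quot_of_zero hN hN3 p.2 hp)
  have hIII (A : ℕ) (hA : 0 < A) (hAN : A ≤ (N - 1) / 2) (p : Fin N)
      (hp : ((p : ℕ) : ℤ) ≡ leadingExponent N A [ZMOD N]) :=
    (hJ p).trans (dissection_quot_of_pos hN hN3 p.2 hA hAN hp)
  have hI (p : Fin N) : J p ≠ 0 ↔ ∃ A : ℕ, A ≤ (N - 1) / 2 ∧
      ((p : ℕ) : ℤ) ≡ leadingExponent N A [ZMOD N] := by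
    constructor
    · intro h
      -- If p matches no A, no pentagonal exponent is ≡ p, and the whole component vanishes.
      by_contra! hA
      refine h ?_
      rw [hJ p, dissection_euler_eq_zero, quot, zero_mul]
      intro k hk
      obtain ⟨A, hAN, hd⟩ := exists_dvd_pentagonal_sub hs hNs hN.pos k
      refine hA A hAN (Int.modEq_iff_dvd.mpr ?_)
      simpa using dvd_sub hk hd
    · rintro ⟨A, hAN, hp⟩
      rcases Nat.eq_zero_or_pos A with rfl | hA
      · rw [hII p hp]
        exact mul_ne_zero (pow_ne_zero _ (neg_ne_zero.mpr one_ne_zero))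
          (pow_ne_zero _ PowerSeries.X_ne_zero)
      · rw [hIII A hA hAN p hp]
        exact mul_ne_zero (mul_ne_zero (pow_ne_zero _ (neg_ne_zero.mpr one_ne_zero))
          (pow_ne_zero _ PowerSeries.X_ne_zero)) (isUnit_quot
            (isUnit_theta (by omega) (by omega)) (isUnit_theta hA (by omega))).ne_zero
  refine ⟨?_, hI, fun p hp ↦ hII p ?_, hIII⟩
  · simp only [hI]
    exact ncard_setOf_exists_leadingExponent hN hs hNs
  · simpa [leadingExponent] using hp
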